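/- Let $p\ge 2$, let $\mathbb S^{p-1}$ be the unit sphere of $\mathbb R^p$ with its surface measure $d\boldsymbol x$, and let $P_\ell$ ($\ell\ge 0$) be the Legendre polynomials in dimension $p$: for $p\ge 3$, $$P_\ell(t)=\Big[\frac{\Gamma(\ell+p-2)}{\ell!\,\Gamma(p-2)}\Big]^{-1}C_\ell^{(p-2)/2}(t),$$ where $C_\ell^{a}$ are the Gegenbauer polynomials, so that $P_\ell(1)=1$; for $p=2$, $P_\ell=T_\ell$ is the Chebyshev polynomial of the first kind. Let $n\ge 1$ and let $\boldsymbol x_0,\dots,\boldsymbol x_n$ be an isotropic $n$-step random walk on $\mathbb S^{p-1}$ started at a fixed $\boldsymbol\mu\in\mathbb S^{p-1}$. That is, $\boldsymbol x_0=\boldsymbol\mu$ almost surely, and for $1\le k\le n$ the conditional law of $\boldsymbol x_k$ given $\boldsymbol x_0,\dots,\boldsymbol x_{k-1}$ has the density $\boldsymbol y\mapsto g_{k,k-1}(\boldsymbol x_{k-1}^T\boldsymbol y)$ with respect to $d\boldsymbol y$. Here $g_{k,k-1}:[-1,1]\to[0,\infty)$ is measurable and $\int_{\mathbb S^{p-1}}g_{k,k-1}(\boldsymbol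 c^T\boldsymbol y)\,d\boldsymbol y=1$ for every $\boldsymbol c\in\mathbb S^{p-1}$; the $g_{k,k-1}$ may differ from step to step. Put $$\rho_{k,k-1}=\int_{\mathbb S^{p-1}}g_{k,k-1}(\boldsymbol\mu^T\boldsymbol y)\,\boldsymbol\mu^T\boldsymbol y\,d\boldsymbol y,\qquad \widehat{g_{k,k-1}}_\ell=\int_{\mathbb S^{p-1}}g_{k,k-1}(\boldsymbol\mu^T\boldsymbol y)\,P_\ell(\boldsymbol\mu^T\boldsymbol y)\,d\boldsymbol y .$$ Then, for all $1\le k\le n$ and $\ell\ge 0$, almost surely $$E[\boldsymbol x_{k-1}^T\boldsymbol x_k\mid \boldsymbol x_{k-1}]=\rho_{k,k-1},\qquad E[P_\ell(\boldsymbol x_{k-1}^T\boldsymbol x_k)\mid \boldsymbol x_{k-1}]=\widehat{g_{k,k-1}}_\ell,$$ the mean of the $n$-step direction is $$E[\boldsymbol x_n]=\Big(\prod_{k=1}^n\rho_{k,k-1}\Big)\boldsymbol\mu,$$ and, for all $\ell\ge 0$, the $\ell$-th Fourier coefficient (Legendre moment) of the $n$-step distribution is $$E[P_\ell(\boldsymbol\mu^T\boldsymbol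 x_n)]=\prod_{k=1}^n\widehat{g_{k,k-1}}_\ell .$$ -/

import Mathlib

open MeasureTheory ProbabilityTheory Polynomial

noncomputable section

namespace SphereWalk

/-- The unit hypersphere `S^{p-1}` of `ℝ^p` (Euclidean norm). -/
abbrev Sph (p : ℕ) : Type := Metric.sphere (0 : EuclideanSpace ℝ (Fin p)) 1

/-- The surface measure `dx` on `S^{p-1}`, of total mass the area of the sphere. -/
def surf (p : ℕ) : Measure (Sph p) :=
  (volume : Measure (EuclideanSpace ℝ (Fin p))).toSphere

/-- The cosine `xᵀy` of the angle between two directions. -/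
def cosAngle {p : ℕ} (x y : Sph p) : ℝ :=
  inner ℝ (x : EuclideanSpace ℝ (Fin p)) (y : EuclideanSpace ℝ (Fin p))

/-- The Gegenbauer (ultraspherical) polynomials `C_ℓ^{(a)}`, by their three-term recurrence
`ℓ C_ℓ = 2 (ℓ + a - 1) t C_{ℓ-1} - (ℓ + 2a - 2) C_{ℓ-2}`, `C_0 = 1`, `C_1 = 2 a t`. -/
def gegenbauer (a : ℝ) : ℕ → ℝ[X]
  | 0 => 1
  | 1 => C (2 * a) * X
  | n + 2 => C (1 / ((n : ℝ) + 2)) *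
      (C (2 * ((n : ℝ) + 1 + a)) * X * gegenbauer a (n + 1)
        - C ((n : ℝ) + 2 * a) * gegenbauer a n)

/-- The Legendre polynomial of order `ℓ` in dimension `p`: the Gegenbauer polynomial
`C_ℓ^{((p-2)/2)}` divided by its value `Γ(ℓ+p-2) / (ℓ! Γ(p-2))` at `1`. For `p = 2`, where
`C_ℓ^{(0)}` degenerates, it is the limiting case, the Chebyshev polynomial
`T_ℓ (cos θ) = cos (ℓ θ)`. -/
def legendre (p ℓ : ℕ) : ℝ[X] :=
  if p = 2 then Chebyshev.T ℝ (ℓ : ℤ)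
  else C (Real.Gamma ((ℓ : ℝ) + p - 2) / (ℓ.factorial * Real.Gamma ((p : ℝ) - 2)))⁻¹ *
    gegenbauer (((p : ℝ) - 2) / 2) ℓ

/-- `g` is the profile of a rotationally symmetric probability density on `S^{p-1}`: for each
axis `c`, the function `x ↦ g (cᵀx)` is a probability density for the surface measure. -/
structure IsZonalPDF (p : ℕ) (g : ℝ → ℝ) : Prop where
  measurable : Measurable g
  nonneg : ∀ t ∈ Set.Icc (-1 : ℝ) 1, 0 ≤ g t
  integrable : ∀ c : Sph p, Integrable (fun x => g (cosAngle c x)) (surf p)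
  integral_eq_one : ∀ c : Sph p, ∫ x, g (cosAngle c x) ∂(surf p) = 1

/-- The mean of `cᵀx` under the density `x ↦ g (cᵀx)` with axis `c`. -/
def meanResultant {p : ℕ} (g : ℝ → ℝ) (c : Sph p) : ℝ :=
  ∫ x, g (cosAngle c x) * cosAngle c x ∂(surf p)

/-- The `ℓ`-th Fourier coefficient (Legendre moment) of the density `x ↦ g (cᵀx)`
with axis `c`. -/
def fourierCoeff {p : ℕ} (g : ℝ → ℝ) (c : Sph p) (ℓ : ℕ) : ℝ :=
  ∫ x, g (cosAngle c x) * (legendre p ℓ).eval (cosAngle c x) ∂(surf p)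

/-- The σ-algebra generated by `x_0, …, x_k`. -/
abbrev past {p : ℕ} {Ω : Type*} (x : ℕ → Ω → Sph p) (k : ℕ) : MeasurableSpace Ω :=
  ⨆ j : ℕ, ⨆ _ : j ≤ k, MeasurableSpace.comap (x j) inferInstance

/-- `x_0, …, x_n` is an isotropic `n`-step random walk on `S^{p-1}` started at `μ`: a Markov
chain such that the conditional density of `x_{k+1}` given `x_0, …, x_k` is
`y ↦ g_k (x_kᵀ y)`. Here `g k` governs the step `x_k → x_{k+1}`, for `0 ≤ k < n`; the values of
`x` and `g` at larger indices play no role. -/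
structure IsIsotropicWalk {p : ℕ} {Ω : Type*} [MeasurableSpace Ω] (P : Measure Ω) (n : ℕ)
    (μ : Sph p) (g : ℕ → ℝ → ℝ) (x : ℕ → Ω → Sph p) : Prop where
  measurable : ∀ k ≤ n, Measurable (x k)
  init : ∀ᵐ ω ∂P, x 0 ω = μ
  density : ∀ k < n, IsZonalPDF p (g k)
  step : ∀ k < n, ∀ A : Set (Sph p), MeasurableSet A →
    P⟦x (k + 1) ⁻¹' A | past x k⟧
      =ᵐ[P] fun ω => ∫ y in A, g k (cosAngle (x k ω) y) ∂(surf p)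

end SphereWalk

end

/-!
Let `κ_k(c, dy) = g_k(cᵀy) dy` be the transition kernel of the `k`-th step. Everything rests on the
Funk–Hecke formula (`funk_hecke`)

  `∫ g(cᵀy) P_ℓ(uᵀy) dy = ĝ_ℓ P_ℓ(uᵀc)`,

which says that the functions `y ↦ P_ℓ(uᵀy)` are eigenfunctions of every kernel `κ_k`, with the
Fourier coefficient of `g_k` as eigenvalue. Each step therefore multiplies `E[P_ℓ(uᵀx_k)]` by one
coefficient, for every pole `u` (`integral_legendre`). The Legendre moments are the case `u = μ`,
where `P_ℓ(1) = 1`; the mean direction is the case `ℓ = 1`, where `P_1(t) = t`, with `u` running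
over the coordinate axes. The conditional expectations are integrals against `κ_k` at `x_k`, and
are constant because zonal integrals do not depend on the axis.

For the Funk–Hecke formula, write `u = t c + r w` with `w` a unit vector orthogonal to `c`, so that
`uᵀy = t s + r v` for the coordinates `s = cᵀy` and `v = wᵀy`. Expanding, and dropping the odd powers
of `v` by symmetry, shows that `∫ g(cᵀy) Q(uᵀy) dy` is a polynomial `avg Q` in `t`
(`integral_zonal_mul_eval`). Its coefficients are the moments `∫ g(s) s^i v^{2j} dy`, and the
rotations about `c` impose on them a recurrence in `j` (`zonalMoment_recurrence`). By this recurrence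
`avg` commutes with the Gegenbauer operator `(1 - t²) ∂² - (p - 1) t ∂` (`gegenbauerOp_avg`). The
polynomial `P_ℓ` is an eigenvector of that operator (`gegenbauerOp_legendre`), and its eigenspaces on
polynomials are lines (`eq_eval_one_mul_legendre`), so `avg P_ℓ` is a multiple of `P_ℓ`. Evaluation
at `t = 1`, that is `u = c`, identifies the factor as `ĝ_ℓ`.
-/

namespace SphereWalk

/-! ### Legendre polynomials and the Gegenbauer operator -/

lemma legendre_zero (p : ℕ) (hp : 2 ≤ p) : legendre p 0 = 1 := by
  unfold legendre
  split_ifs with h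
  · simp
  · have h3 : (3 : ℝ) ≤ p := by exact_mod_cast (by omega : 3 ≤ p)
    have : Real.Gamma ((p : ℝ) - 2) ≠ 0 := (Real.Gamma_pos_of_pos (by linarith)).ne'
    simp [gegenbauer, this]

/-- The ratio of the values at `1` of consecutive Gegenbauer polynomials, with `d = p - 2`. -/
lemma gegenbauerValue_succ {d : ℝ} (hd : 0 < d) (ℓ : ℕ) :
    Real.Gamma (((ℓ + 1 : ℕ) : ℝ) + d) / ((ℓ + 1).factorial * Real.Gamma d) =
      (ℓ + d) / (ℓ + 1) * (Real.Gamma (ℓ + d) / (ℓ.factorial * Real.Gamma d)) := by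
  have h1 : ((ℓ + 1 : ℕ) : ℝ) + d = (ℓ + d) + 1 := by push_cast; ring
  have h2 : Real.Gamma d ≠ 0 := (Real.Gamma_pos_of_pos hd).ne'
  have h3 : ((ℓ.factorial : ℕ) : ℝ) ≠ 0 := by positivity
  have h4 : (ℓ : ℝ) + 1 ≠ 0 := by positivity
  rw [h1, Real.Gamma_add_one (by positivity), Nat.factorial_succ]
  push_cast
  field_simp

lemma legendre_one (p : ℕ) (hp : 2 ≤ p) : legendre p 1 = X := by
  unfold legendre
  split_ifs with h
  · simp
  · have h3 : (3 : ℝ) ≤ p := by exact_mod_cast (by omega : 3 ≤ p)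
    have hd : 0 < (p : ℝ) - 2 := by linarith
    have h := gegenbauerValue_succ hd 0
    have h2 : Real.Gamma ((p : ℝ) - 2) ≠ 0 := (Real.Gamma_pos_of_pos hd).ne'
    have h4 : Real.Gamma (((1 : ℕ) : ℝ) + p - 2) / ((1 : ℕ).factorial * Real.Gamma ((p : ℝ) - 2))
        = (p : ℝ) - 2 := by
      rw [add_sub_assoc]
      rw [zero_add] at h
      rw [h]
      simp [h2]
    rw [h4, gegenbauer, ← mul_assoc, ← C_mul]
    have h5 : ((p : ℝ) - 2)⁻¹ * (2 * (((p : ℝ) - 2) / 2)) = 1 := by field_simp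
    rw [h5]
    simp

/-- The three-term recurrence of the normalised polynomials. It has the same form for `p = 2`
(Chebyshev) as for `p ≥ 3` (Gegenbauer), so the two cases are not distinguished afterwards. -/
lemma legendre_add_two (p : ℕ) (hp : 2 ≤ p) (ℓ : ℕ) :
    C ((ℓ : ℝ) + p - 1) * legendre p (ℓ + 2) =
      C (2 * (ℓ : ℝ) + p) * X * legendre p (ℓ + 1) - C ((ℓ : ℝ) + 1) * legendre p ℓ := by
  unfold legendre
  split_ifs with h
  · subst h
    have h := Chebyshev.T_add_two ℝ (ℓ : ℤ)
    push_cast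
    rw [h]
    simp only [map_add, map_mul, map_sub, C_1, map_ofNat]
    ring
  · have h3 : (3 : ℝ) ≤ p := by exact_mod_cast (by omega : 3 ≤ p)
    have hd : 0 < (p : ℝ) - 2 := by linarith
    have s1 := gegenbauerValue_succ hd ℓ
    have s2 := gegenbauerValue_succ hd (ℓ + 1)
    have hpos : 0 < Real.Gamma (ℓ + ((p : ℝ) - 2)) / (ℓ.factorial * Real.Gamma ((p : ℝ) - 2)) := by
      have := Real.Gamma_pos_of_pos hd
      have := Real.Gamma_pos_of_pos (by positivity : 0 < ℓ + ((p : ℝ) - 2))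
      positivity
    have s2' : Real.Gamma (((ℓ + 2 : ℕ) : ℝ) + (p - 2)) /
        ((ℓ + 2).factorial * Real.Gamma ((p : ℝ) - 2)) =
        ((ℓ : ℝ) + 1 + (p - 2)) / (ℓ + 2) * ((ℓ + (p - 2)) / (ℓ + 1) *
          (Real.Gamma (ℓ + ((p : ℝ) - 2)) / (ℓ.factorial * Real.Gamma ((p : ℝ) - 2)))) := by
      rw [s2, s1]
      push_cast
      rw [add_assoc (ℓ : ℝ) 1 1, one_add_one_eq_two]
    simp only [add_sub_assoc]
    rw [s1, s2']
    set G := Real.Gamma (ℓ + ((p : ℝ) - 2)) / (ℓ.factorial * Real.Gamma ((p : ℝ) - 2))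
    rw [gegenbauer]
    set A := gegenbauer (((p : ℝ) - 2) / 2) ℓ
    set B := gegenbauer (((p : ℝ) - 2) / 2) (ℓ + 1)
    set d := (p : ℝ) - 2 with hdd
    have hp' : (p : ℝ) = d + 2 := by rw [hdd]; ring
    rw [hp']
    have hl : (ℓ : ℝ) + 1 ≠ 0 := by positivity
    have hl2 : (ℓ : ℝ) + 2 ≠ 0 := by positivity
    have hld : (ℓ : ℝ) + d ≠ 0 := by positivity
    have hld1 : (ℓ : ℝ) + 1 + d ≠ 0 := by positivity
    have e1 : ((ℓ : ℝ) + (d + 2 - 1)) * (((ℓ : ℝ) + 1 + d) / (ℓ + 2) *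
        ((ℓ + d) / (ℓ + 1) * G))⁻¹ * (1 / ((ℓ : ℝ) + 2)) * (2 * ((ℓ : ℝ) + 1 + d / 2)) =
        (2 * ℓ + (d + 2)) * ((ℓ + d) / (ℓ + 1) * G)⁻¹ := by
      field_simp
      ring
    have e2 : ((ℓ : ℝ) + (d + 2 - 1)) * (((ℓ : ℝ) + 1 + d) / (ℓ + 2) *
        ((ℓ + d) / (ℓ + 1) * G))⁻¹ * (1 / ((ℓ : ℝ) + 2)) * ((ℓ : ℝ) + 2 * (d / 2)) =
        (ℓ + 1) * G⁻¹ := by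
      field_simp
      ring
    have f1 := congrArg (C : ℝ → ℝ[X]) e1
    have f2 := congrArg (C : ℝ → ℝ[X]) e2
    simp only [C_mul] at f1 f2 ⊢
    linear_combination X * B * f1 - A * f2

lemma legendre_eval_one (p : ℕ) (hp : 2 ≤ p) (ℓ : ℕ) : (legendre p ℓ).eval 1 = 1 := by
  induction ℓ using Nat.twoStepInduction with
  | zero => simp [legendre_zero p hp]
  | one => simp [legendre_one p hp]
  | more n h0 h1 =>
    have h := congrArg (eval 1) (legendre_add_two p hp n)
    simp only [eval_mul, eval_sub, eval_C, eval_X, h0, h1] at h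
    have hp' : (2 : ℝ) ≤ p := by exact_mod_cast hp
    have : (n : ℝ) + p - 1 ≠ 0 := by
      have : (0 : ℝ) ≤ n := by positivity
      linarith
    apply mul_left_cancel₀ this
    linarith

/-- The Gegenbauer operator `Q ↦ (1 - t²) Q'' - (d + 1) t Q'`. For `d = p - 2` it is the
Laplace-Beltrami operator of `S^{p-1}` on functions `y ↦ Q (cᵀy)` of one coordinate. -/
noncomputable def gegenbauerOp (d : ℝ) : ℝ[X] →ₗ[ℝ] ℝ[X] :=
  LinearMap.mulLeft ℝ (1 - X ^ 2) ∘ₗ derivative ∘ₗ derivative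
    - LinearMap.mulLeft ℝ (C (d + 1) * X) ∘ₗ derivative

lemma gegenbauerOp_apply (d : ℝ) (Q : ℝ[X]) :
    gegenbauerOp d Q =
      (1 - X ^ 2) * derivative (derivative Q) - C (d + 1) * X * derivative Q := rfl

/-- The two first-order relations between consecutive Legendre polynomials; either one follows
from the other by the three-term recurrence. -/
lemma one_sub_X_sq_mul_derivative_legendre (p : ℕ) (hp : 2 ≤ p) (ℓ : ℕ) :
    (1 - X ^ 2) * derivative (legendre p ℓ) =
        C ((ℓ : ℝ) + p - 2) * (X * legendre p ℓ - legendre p (ℓ + 1)) ∧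
    (1 - X ^ 2) * derivative (legendre p (ℓ + 1)) =
        C ((ℓ : ℝ) + 1) * (legendre p ℓ - X * legendre p (ℓ + 1)) := by
  induction ℓ with
  | zero =>
    simp only [zero_add, legendre_zero p hp, legendre_one p hp]
    constructor <;> simp
    ring
  | succ n ih =>
    obtain ⟨h1, h2⟩ := ih
    have r := legendre_add_two p hp n
    have hr := congrArg derivative r
    simp only [derivative_mul, derivative_sub, derivative_C, derivative_X] at hr
    have hp' : (2 : ℝ) ≤ p := by exact_mod_cast hp
    have hn : (n : ℝ) + p - 1 ≠ 0 := by
      have : (0 : ℝ) ≤ n := by positivity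
      linarith
    have key : (1 - X ^ 2) * derivative (legendre p (n + 1)) =
        C (((n + 1 : ℕ) : ℝ) + p - 2) * (X * legendre p (n + 1) - legendre p (n + 1 + 1)) := by
      rw [h2]
      push_cast
      simp only [C_add, C_sub, C_mul, map_one, map_natCast, map_ofNat] at r ⊢
      linear_combination r
    refine ⟨key, ?_⟩
    have hC : (C ((n : ℝ) + p - 1) : ℝ[X]) ≠ 0 := C_ne_zero.2 hn
    apply mul_left_cancel₀ hC
    push_cast at key ⊢
    simp only [C_add, C_sub, C_mul, map_one, map_natCast, map_ofNat] at r hr key h1 h2 ⊢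
    linear_combination (1 - X ^ 2) * hr - ((n : ℝ[X]) + 1) * h1 +
      (2 * (n : ℝ[X]) + p) * X * key - ((n : ℝ[X]) + p - 2) * X * r

/-- Legendre polynomials are eigenvectors of the Gegenbauer operator. -/
lemma gegenbauerOp_legendre (p : ℕ) (hp : 2 ≤ p) (ℓ : ℕ) :
    gegenbauerOp ((p : ℝ) - 2) (legendre p ℓ) =
      -(C ((ℓ : ℝ) * (ℓ + (p - 2))) * legendre p ℓ) := by
  obtain ⟨h1, h2⟩ := one_sub_X_sq_mul_derivative_legendre p hp ℓ
  -- the first-order relations determine only `(1 - X²) P_ℓ'`, so the equation is checked after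
  -- multiplication by `1 - X²`
  have hX : (1 - X ^ 2 : ℝ[X]) ≠ 0 := by
    intro h
    have := congrArg (eval 0) h
    simp at this
  apply mul_left_cancel₀ hX
  have h3 := congrArg derivative h1
  simp only [derivative_mul, derivative_sub, derivative_C, derivative_X, derivative_one,
    derivative_X_pow] at h3
  rw [gegenbauerOp_apply]
  simp only [C_add, C_sub, C_mul, map_one, map_natCast, map_ofNat] at h1 h2 h3 ⊢
  linear_combination (1 - X ^ 2) * h3 - ((ℓ : ℝ[X]) + p - 2) * h2 +
      ((ℓ : ℝ[X]) + 1) * X * h1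

lemma coeff_gegenbauerOp (d : ℝ) (Q : ℝ[X]) (m : ℕ) :
    (gegenbauerOp d Q).coeff m =
      (m + 2) * (m + 1) * Q.coeff (m + 2) - m * (m + d) * Q.coeff m := by
  rw [gegenbauerOp_apply, sub_mul, one_mul, mul_assoc, coeff_sub, coeff_sub, coeff_C_mul]
  have hXX : ∀ R : ℝ[X], (X ^ 2 * R).coeff m = if 2 ≤ m then R.coeff (m - 2) else 0 := by
    intro R
    rw [mul_comm, coeff_mul_X_pow']
  rw [hXX]
  rcases m with _ | _ | m
  · simp [coeff_derivative]; ring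
  · simp [coeff_derivative, coeff_X_mul]; ring
  · simp [coeff_derivative, coeff_X_mul]; ring

/-- Comparing top coefficients: the eigenvalues `-m (m + d)` are distinct, so a nonzero
eigenvector for the `ℓ`-th one has degree `ℓ`. -/
lemma natDegree_of_gegenbauerOp_eq {d : ℝ} (hd : 0 ≤ d) {ℓ : ℕ} {Q : ℝ[X]} (hQ : Q ≠ 0)
    (h : gegenbauerOp d Q = -(C ((ℓ : ℝ) * (ℓ + d)) * Q)) : Q.natDegree = ℓ := by
  have hc := congrArg (fun R => R.coeff Q.natDegree) h
  simp only [coeff_gegenbauerOp, coeff_neg, coeff_C_mul] at hc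
  rw [coeff_eq_zero_of_natDegree_lt (by omega : Q.natDegree < Q.natDegree + 2)] at hc
  have hl : Q.coeff Q.natDegree ≠ 0 := leadingCoeff_ne_zero.2 hQ
  have h1 : ((Q.natDegree : ℝ) - ℓ) * (Q.natDegree + ℓ + d) = 0 := by
    apply mul_right_cancel₀ hl
    linarith
  rcases mul_eq_zero.1 h1 with h2 | h2
  · exact_mod_cast sub_eq_zero.1 h2
  · have a1 : (0 : ℝ) ≤ Q.natDegree := by positivity
    have a2 : (0 : ℝ) ≤ ℓ := by positivity
    have b1 : (Q.natDegree : ℝ) = 0 := by linarith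
    have b2 : (ℓ : ℝ) = 0 := by linarith
    exact_mod_cast b1.trans b2.symm

/-- The eigenspaces of the Gegenbauer operator on polynomials are spanned by the Legendre
polynomials. -/
lemma eq_eval_one_mul_legendre (p : ℕ) (hp : 2 ≤ p) (ℓ : ℕ) {Q : ℝ[X]}
    (h : gegenbauerOp ((p : ℝ) - 2) Q = -(C ((ℓ : ℝ) * (ℓ + (p - 2))) * Q)) :
    Q = C (Q.eval 1) * legendre p ℓ := by
  have hd : (0 : ℝ) ≤ (p : ℝ) - 2 := by
    have : (2 : ℝ) ≤ p := by exact_mod_cast hp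
    linarith
  have hP := gegenbauerOp_legendre p hp ℓ
  set L := legendre p ℓ
  have hL1 : L.eval 1 = 1 := legendre_eval_one p hp ℓ
  have hL0 : L ≠ 0 := by
    intro h0
    simp [h0] at hL1
  -- an eigenvector without a term of degree `ℓ` vanishes
  have hS : Q.coeff ℓ • L - L.coeff ℓ • Q = 0 := by
    by_contra hne
    have hdeg := natDegree_of_gegenbauerOp_eq hd (ℓ := ℓ) hne (by
      rw [map_sub, map_smul, map_smul, hP, h]
      simp only [smul_eq_C_mul]
      ring)
    apply leadingCoeff_ne_zero.2 hne
    rw [leadingCoeff, hdeg]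
    simp [mul_comm]
  have hl : L.coeff ℓ ≠ 0 := by
    have := leadingCoeff_ne_zero.2 hL0
    rwa [leadingCoeff, natDegree_of_gegenbauerOp_eq hd hL0 hP] at this
  have hev := congrArg (eval 1) hS
  simp only [eval_sub, eval_smul, hL1, eval_zero, smul_eq_mul, mul_one] at hev
  rw [sub_eq_zero.1 hev] at hS
  have := sub_eq_zero.1 hS
  rw [mul_smul] at this
  rw [← smul_eq_C_mul]
  exact (smul_right_injective _ hl this).symm

/-! ### Averaging a polynomial over rotations about an axis -/

/-- For a table `I i j` of moments `∫ s^i v^{2j}`, the polynomial in `t` that represents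
`∫ (t s + √(1 - t²) v)^m`; the odd powers of `v` are taken to integrate to `0`. The summands with
`2 j > m` vanish, by the binomial coefficient. -/
noncomputable def avgPow (I : ℕ → ℕ → ℝ) (m : ℕ) : ℝ[X] :=
  ∑ j ∈ Finset.range (m + 1),
    C (m.choose (2 * j) * I (m - 2 * j) j) * (X ^ (m - 2 * j) * (1 - X ^ 2) ^ j)

lemma avgPow_eq_sum_range (I : ℕ → ℕ → ℝ) {m N : ℕ} (h : m + 1 ≤ N) :
    avgPow I m = ∑ j ∈ Finset.range N,
      C (m.choose (2 * j) * I (m - 2 * j) j) * (X ^ (m - 2 * j) * (1 - X ^ 2) ^ j) := by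
  refine Finset.sum_subset (Finset.range_mono h) fun j _ hj => ?_
  have : m < 2 * j := by simp at hj; omega
  simp [Nat.choose_eq_zero_of_lt this]

lemma derivative_X_pow_mul_one_sub_X_sq_pow (i j : ℕ) :
    derivative (X ^ i * (1 - X ^ 2) ^ j : ℝ[X]) =
      (i : ℝ[X]) * (X ^ (i - 1) * (1 - X ^ 2) ^ j)
        - 2 * (j : ℝ[X]) * (X ^ (i + 1) * (1 - X ^ 2) ^ (j - 1)) := by
  simp only [derivative_mul, derivative_pow, derivative_sub, derivative_one, derivative_X,
    map_natCast, Nat.cast_ofNat, Nat.add_one_sub_one, pow_one,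
    map_ofNat]
  ring

/-- The polynomial is the restriction to the unit sphere of `a^i b^{2j}`, where `a` is one coordinate
and `b` the length of the remaining `d + 1`. The first two terms are the restriction of its Euclidean
Laplacian, the last is the correction by the degree of homogeneity `i + 2j`. -/
lemma gegenbauerOp_X_pow_mul (d : ℝ) (i j : ℕ) :
    gegenbauerOp d (X ^ i * (1 - X ^ 2) ^ j) =
      C ((i : ℝ) * (i - 1)) * (X ^ (i - 2) * (1 - X ^ 2) ^ j)
        + C (2 * (j : ℝ) * (2 * j + d - 1)) * (X ^ i * (1 - X ^ 2) ^ (j - 1))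
        - C (((i : ℝ) + 2 * j) * (i + 2 * j + d)) * (X ^ i * (1 - X ^ 2) ^ j) := by
  have h2 : derivative (2 * (j : ℝ[X])) = 0 := by simp
  rw [gegenbauerOp_apply, derivative_X_pow_mul_one_sub_X_sq_pow, derivative_sub,
    derivative_mul, derivative_natCast, derivative_mul (f := 2 * (j : ℝ[X])), h2,
    derivative_X_pow_mul_one_sub_X_sq_pow, derivative_X_pow_mul_one_sub_X_sq_pow]
  simp only [C_add, C_sub, C_mul, map_one, map_natCast, map_ofNat]
  rcases i with _ | _ | i <;> rcases j with _ | _ | j <;>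
  · simp only [zero_add, Nat.zero_sub, Nat.sub_self, Nat.add_one_sub_one,
      show ∀ k, k + 1 + 1 - 2 = k from fun k => rfl, Nat.cast_add, Nat.cast_one, Nat.cast_zero]
    ring

lemma choose_mul_add_two (i k : ℕ) :
    ((i + 2 + k).choose k : ℝ) * ((i + 2) * (i + 1)) =
      (i + k + 2) * (i + k + 1) * ((i + k).choose k) := by
  have h1 := Nat.add_one_mul_choose_eq (i + k + 1) (i + 1)
  have h2 := Nat.add_one_mul_choose_eq (i + k) i
  have e1 : (i + 2 + k).choose k = (i + k + 1 + 1).choose (i + 1 + 1) := by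
    rw [← Nat.choose_symm_add]; congr 1; ring
  have e2 : (i + k).choose k = (i + k).choose i := by
    rw [← Nat.choose_symm_add]
  rw [e1, e2]
  have h1' : ((i : ℝ) + k + 1 + 1) * (i + k + 1).choose (i + 1) =
    (i + k + 1 + 1).choose (i + 1 + 1) * (i + 1 + 1) := by exact_mod_cast h1
  have h2' : ((i : ℝ) + k + 1) * (i + k).choose i =
    (i + k + 1).choose (i + 1) * (i + 1) := by exact_mod_cast h2
  linear_combination (-(i : ℝ) - 1) * h1' - ((i : ℝ) + k + 2) * h2'

lemma choose_add_two_mul (i k : ℕ) :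
    ((i + k + 2).choose (k + 2) : ℝ) * ((k + 2) * (k + 1)) =
      (i + k + 2) * (i + k + 1) * ((i + k).choose k) := by
  have h := choose_mul_add_two k i
  have e1 : (k + 2 + i).choose i = (i + k + 2).choose (k + 2) := by
    rw [← Nat.choose_symm_add]; congr 1; ring
  have e2 : (k + i).choose i = (i + k).choose k := by
    rw [← Nat.choose_symm_add, add_comm]
  rw [e1, e2] at h
  rw [h]; ring

/-- The moment recurrence `hI` turns the averaged monomials into the image of the monomials under
a map commuting with the Laplace-Beltrami operator. -/
lemma gegenbauerOp_avgPow (d : ℝ) (I : ℕ → ℕ → ℝ)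
    (hI : ∀ i j : ℕ, (2 * (j : ℝ) + 1) * (I i j - I (i + 2) j) =
      (2 * j + 1 + d) * I i (j + 1))
    (m : ℕ) :
    gegenbauerOp d (avgPow I m) =
      C ((m : ℝ) * (m - 1)) * avgPow I (m - 2) - C ((m : ℝ) * (m + d)) * avgPow I m := by
  -- the operator applied to each summand, the eigenvalue part being common to all of them
  have hterm : ∀ j, gegenbauerOp d (C (m.choose (2 * j) * I (m - 2 * j) j) *
        (X ^ (m - 2 * j) * (1 - X ^ 2) ^ j)) =
      C (m.choose (2 * j) * I (m - 2 * j) j * (((m - 2 * j : ℕ) : ℝ) * ((m - 2 * j : ℕ) - 1))) *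
        (X ^ (m - 2 - 2 * j) * (1 - X ^ 2) ^ j)
      + C (m.choose (2 * j) * I (m - 2 * j) j * (2 * (j : ℝ) * (2 * j + d - 1))) *
        (X ^ (m - 2 * j) * (1 - X ^ 2) ^ (j - 1))
      - C ((m : ℝ) * (m + d)) * (C (m.choose (2 * j) * I (m - 2 * j) j) *
        (X ^ (m - 2 * j) * (1 - X ^ 2) ^ j)) := by
    intro j
    rcases lt_or_ge m (2 * j) with h | h
    · simp [Nat.choose_eq_zero_of_lt h]
    · obtain ⟨i, rfl⟩ := Nat.exists_eq_add_of_le h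
      have e : 2 * j + i - 2 - 2 * j = i - 2 := by omega
      rw [← smul_eq_C_mul, map_smul, Nat.add_sub_cancel_left, e, gegenbauerOp_X_pow_mul]
      simp only [smul_eq_C_mul]
      push_cast
      simp only [C_mul]
      ring_nf
  rw [avgPow, map_sum, Finset.sum_congr rfl fun j _ => hterm j, Finset.sum_sub_distrib,
    ← Finset.mul_sum, ← avgPow]
  congr 1
  -- shifting the second sum by one pairs the summands of equal monomial
  rw [Finset.sum_add_distrib, Finset.sum_range_succ' (fun j =>
    C (m.choose (2 * j) * I (m - 2 * j) j * (2 * (j : ℝ) * (2 * j + d - 1))) *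
        (X ^ (m - 2 * j) * (1 - X ^ 2 : ℝ[X]) ^ (j - 1)))]
  simp only [Nat.cast_zero, mul_zero, zero_mul, C_0, add_zero, Nat.add_sub_cancel]
  rcases m with _ | _ | m
  · simp
  · simp [Finset.sum_range_succ]
  · rw [Finset.sum_range_succ _ (m + 2), Nat.choose_eq_zero_of_lt (by omega : m + 2 < 2 * (m + 2)),
      show m + 1 + 1 - 2 = m from rfl, avgPow_eq_sum_range I (show m + 1 ≤ m + 2 by omega), Finset.mul_sum]
    simp only [Nat.cast_zero, zero_mul, C_0, add_zero]
    rw [← Finset.sum_add_distrib]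
    refine Finset.sum_congr rfl fun j _ => ?_
    have e0 : m + 2 - 2 * (j + 1) = m - 2 * j := by omega
    rw [e0, ← add_mul, ← C_add, ← mul_assoc (C _) (C _), ← C_mul]
    congr 2
    rcases lt_or_ge m (2 * j) with h | h
    · have h3 : (((m + 2 - 2 * j : ℕ) : ℝ) * ((m + 2 - 2 * j : ℕ) - 1)) = 0 := by
        rcases (by omega : m + 2 - 2 * j = 0 ∨ m + 2 - 2 * j = 1) with h | h <;> simp [h]
      rw [h3, Nat.choose_eq_zero_of_lt h,
        Nat.choose_eq_zero_of_lt (by omega : m + 2 < 2 * (j + 1))]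
      simp
    · obtain ⟨i, rfl⟩ := Nat.exists_eq_add_of_le' h
      have e1 : i + 2 * j + 2 - 2 * j = i + 2 := by omega
      have c1 := choose_mul_add_two i (2 * j)
      have c2 := choose_add_two_mul i (2 * j)
      have e2 : i + 2 + 2 * j = i + 2 * j + 2 := by omega
      rw [e2] at c1
      rw [e1, Nat.add_sub_cancel, show 2 * (j + 1) = 2 * j + 2 by ring]
      push_cast at c1 c2 ⊢
      have hj : 2 * (j : ℝ) + 1 ≠ 0 := by positivity
      apply mul_left_cancel₀ hj
      linear_combination (2 * (j : ℝ) + 1) * I (i + 2) j * c1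
        - (((i + 2 * j + 2).choose (2 * j + 2) : ℝ) * (2 * j + 2) * (2 * j + 1)) * hI i j
        + ((2 * (j : ℝ) + 1) * (I i j - I (i + 2) j)) * c2

/-- The linear extension of `X ^ m ↦ avgPow I m` to all polynomials. -/
noncomputable def avg (I : ℕ → ℕ → ℝ) : ℝ[X] →ₗ[ℝ] ℝ[X] :=
  (Polynomial.basisMonomials ℝ).constr ℝ (avgPow I)

lemma avg_X_pow (I : ℕ → ℕ → ℝ) (m : ℕ) : avg I (X ^ m) = avgPow I m := by
  have := (Polynomial.basisMonomials ℝ).constr_basis ℝ (avgPow I) m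
  simp only [coe_basisMonomials, monomial_one_right_eq_X_pow] at this
  exact this

/-- Averaging over rotations, for moments obeying the recurrence `hI`, commutes with the
Laplace-Beltrami operator. -/
lemma gegenbauerOp_avg (d : ℝ) (I : ℕ → ℕ → ℝ)
    (hI : ∀ i j : ℕ, (2 * (j : ℝ) + 1) * (I i j - I (i + 2) j) =
      (2 * j + 1 + d) * I i (j + 1))
    (Q : ℝ[X]) : gegenbauerOp d (avg I Q) = avg I (gegenbauerOp d Q) := by
  induction Q using Polynomial.induction_on' with
  | add p q hp hq => simp only [map_add, hp, hq]
  | monomial m a =>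
    have h := gegenbauerOp_X_pow_mul d m 0
    simp only [pow_zero, mul_one, Nat.cast_zero, mul_zero, zero_mul, C_0, add_zero,
      ← smul_eq_C_mul] at h
    rw [← C_mul_X_pow_eq_monomial, ← smul_eq_C_mul]
    simp only [map_smul, avg_X_pow, h, map_sub, gegenbauerOp_avgPow d I hI, ← smul_eq_C_mul]

/-! ### Rotational invariance of the surface measure -/

variable {p : ℕ}

lemma continuous_inner_sph (a : EuclideanSpace ℝ (Fin p)) :
    Continuous fun y : Sph p => inner ℝ a (y : EuclideanSpace ℝ (Fin p)) :=
  continuous_const.inner continuous_subtype_val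

lemma cosAngle_comm (x y : Sph p) : cosAngle x y = cosAngle y x := real_inner_comm _ _

lemma cosAngle_self (x : Sph p) : cosAngle x x = 1 := by
  have h : ‖(x : EuclideanSpace ℝ (Fin p))‖ = 1 := by simp
  rw [cosAngle, real_inner_self_eq_norm_sq, h, one_pow]

lemma continuous_cosAngle : Continuous fun q : Sph p × Sph p => cosAngle q.1 q.2 :=
  (continuous_subtype_val.comp continuous_fst).inner (continuous_subtype_val.comp continuous_snd)

lemma cosAngle_mem_Icc (x y : Sph p) : cosAngle x y ∈ Set.Icc (-1 : ℝ) 1 := by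
  have h : |cosAngle x y| ≤ 1 := by
    refine (abs_real_inner_le_norm _ _).trans ?_
    simp
  exact abs_le.1 h

instance : IsFiniteMeasure (surf p) := by unfold surf; infer_instance

/-- The action of a linear isometry on the sphere. -/
noncomputable def sphereEquiv (R : EuclideanSpace ℝ (Fin p) ≃ₗᵢ[ℝ] EuclideanSpace ℝ (Fin p)) :
    Sph p ≃ᵐ Sph p where
  toFun := fun y => ⟨R y, by simp⟩
  invFun := fun y => ⟨R.symm y, by simp⟩
  left_inv := fun y => by simp
  right_inv := fun y => by simp
  measurable_toFun := by
    exact (R.continuous.measurable.comp measurable_subtype_coe).subtype_mk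
  measurable_invFun := by
    exact (R.symm.continuous.measurable.comp measurable_subtype_coe).subtype_mk

@[simp]
lemma coe_sphereEquiv (R : EuclideanSpace ℝ (Fin p) ≃ₗᵢ[ℝ] EuclideanSpace ℝ (Fin p))
    (y : Sph p) : (sphereEquiv R y : EuclideanSpace ℝ (Fin p)) = R y := rfl

open scoped Pointwise in
lemma measurePreserving_sphereEquiv
    (R : EuclideanSpace ℝ (Fin p) ≃ₗᵢ[ℝ] EuclideanSpace ℝ (Fin p)) :
    MeasurePreserving (sphereEquiv R) (surf p) (surf p) := by
  refine ⟨(sphereEquiv R).measurable, Measure.ext fun s hs => ?_⟩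
  rw [(sphereEquiv R).map_apply, surf, Measure.toSphere_apply' _ hs,
    Measure.toSphere_apply' _ ((sphereEquiv R).measurable hs)]
  congr 1
  rw [← R.measurePreserving.measure_preimage_equiv (f := R.toMeasurableEquiv)
    (Set.Ioo (0 : ℝ) 1 • (Subtype.val '' s))]
  congr 1
  ext y
  simp only [Set.mem_smul, Set.mem_image, Set.mem_preimage]
  constructor
  · rintro ⟨r, hr, _, ⟨z, hz, rfl⟩, rfl⟩
    exact ⟨r, hr, _, ⟨_, hz, rfl⟩, by simp⟩
  · rintro ⟨r, hr, _, ⟨z, hz, rfl⟩, h⟩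
    refine ⟨r, hr, _, ⟨(sphereEquiv R).symm z, by simpa using hz, rfl⟩, ?_⟩
    apply R.injective
    rw [map_smul, ← coe_sphereEquiv, MeasurableEquiv.apply_symm_apply]
    exact h

lemma integral_comp_sphereEquiv
    (R : EuclideanSpace ℝ (Fin p) ≃ₗᵢ[ℝ] EuclideanSpace ℝ (Fin p)) (f : Sph p → ℝ) :
    ∫ y, f (sphereEquiv R y) ∂surf p = ∫ y, f y ∂surf p :=
  (measurePreserving_sphereEquiv R).integral_comp' f

/-- Vectors of equal length are exchanged by a reflection, which fixes whatever has the same inner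
product with both. -/
lemma exists_isometry_apply_eq {a a' : EuclideanSpace ℝ (Fin p)} (h : ‖a‖ = ‖a'‖) :
    ∃ R : EuclideanSpace ℝ (Fin p) ≃ₗᵢ[ℝ] EuclideanSpace ℝ (Fin p), R a = a' ∧
      ∀ c, inner ℝ a c = inner ℝ a' c → R c = c := by
  refine ⟨(Submodule.span ℝ {a - a'})ᗮ.reflection, Submodule.reflection_sub h, fun c hc => ?_⟩
  apply Submodule.reflection_mem_subspace_eq_self
  rw [Submodule.mem_orthogonal_singleton_iff_inner_right, inner_sub_left, hc, sub_self]

/-- The integral of a function of the cosine alone does not depend on the axis, by a reflection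
exchanging the two axes. -/
lemma integral_zonal_eq (h : ℝ → ℝ) (c c' : Sph p) :
    ∫ y, h (cosAngle c y) ∂surf p = ∫ y, h (cosAngle c' y) ∂surf p := by
  obtain ⟨R, hR, -⟩ := exists_isometry_apply_eq (p := p) (a := c) (a' := c') (by simp)
  rw [← integral_comp_sphereEquiv R (fun y => h (cosAngle c' y))]
  simp only [cosAngle, coe_sphereEquiv, ← hR, R.inner_map_map]

lemma meanResultant_eq_fourierCoeff_one (hp : 2 ≤ p) (g : ℝ → ℝ) (c : Sph p) :
    meanResultant g c = fourierCoeff g c 1 := by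
  simp [meanResultant, fourierCoeff, legendre_one p hp]

lemma fourierCoeff_eq (g : ℝ → ℝ) (c c' : Sph p) (ℓ : ℕ) :
    fourierCoeff g c ℓ = fourierCoeff g c' ℓ :=
  integral_zonal_eq (fun t => g t * (legendre p ℓ).eval t) c c'

lemma integrable_zonal_mul {g : ℝ → ℝ} {c : Sph p}
    (hg : Integrable (fun y => g (cosAngle c y)) (surf p)) {f : Sph p → ℝ} (hf : Continuous f) :
    Integrable (fun y => g (cosAngle c y) * f y) (surf p) := by
  obtain ⟨C, hC⟩ := isCompact_univ.exists_bound_of_continuousOn hf.continuousOn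
  exact hg.mul_bdd (c := C) hf.aestronglyMeasurable (ae_of_all _ fun y => hC y trivial)

/-- Zonal integrals are invariant under the isometries that fix the axis: only the length of a
vector `a` orthogonal to the axis matters. -/
lemma integral_zonal_mul_inner_pow (g : ℝ → ℝ) (c : Sph p) {a a' : EuclideanSpace ℝ (Fin p)}
    (h : ‖a‖ = ‖a'‖) (ha : inner ℝ a (c : EuclideanSpace ℝ (Fin p)) = 0)
    (ha' : inner ℝ a' (c : EuclideanSpace ℝ (Fin p)) = 0) (i k : ℕ) :
    ∫ y, g (cosAngle c y) *
        (cosAngle c y ^ i * inner ℝ a (y : EuclideanSpace ℝ (Fin p)) ^ k) ∂surf p =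
      ∫ y, g (cosAngle c y) *
        (cosAngle c y ^ i * inner ℝ a' (y : EuclideanSpace ℝ (Fin p)) ^ k) ∂surf p := by
  obtain ⟨R, hR, hc⟩ := exists_isometry_apply_eq h
  have hRc := hc c (ha.trans ha'.symm)
  rw [← integral_comp_sphereEquiv R (fun y => g (cosAngle c y) *
        (cosAngle c y ^ i * inner ℝ a' (y : EuclideanSpace ℝ (Fin p)) ^ k))]
  refine integral_congr_ae (ae_of_all _ fun y => ?_)
  have e1 : cosAngle c (sphereEquiv R y) = cosAngle c y := by
    rw [cosAngle, coe_sphereEquiv]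
    nth_rewrite 1 [← hRc]
    exact R.inner_map_map _ _
  simp only [e1, coe_sphereEquiv, ← hR, R.inner_map_map]

lemma integral_zonal_mul_inner_pow_odd (g : ℝ → ℝ) (c : Sph p) {w : EuclideanSpace ℝ (Fin p)}
    (hw : inner ℝ w (c : EuclideanSpace ℝ (Fin p)) = 0) (i : ℕ) {k : ℕ} (hk : Odd k) :
    ∫ y, g (cosAngle c y) *
        (cosAngle c y ^ i * inner ℝ w (y : EuclideanSpace ℝ (Fin p)) ^ k) ∂surf p = 0 := by
  have h := integral_zonal_mul_inner_pow g c (norm_neg w).symm hw (by simp [hw]) i k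
  simp only [inner_neg_left, hk.neg_pow, mul_neg, integral_neg] at h
  linarith

/-! ### Moments of a zonal density -/

/-- The mixed moments `∫ g(s) s^i v^{2j}` of a zonal density, where `s` is the coordinate along
the axis `c` and `v` the coordinate along `w`. -/
noncomputable def zonalMoment (g : ℝ → ℝ) (c : Sph p) (w : EuclideanSpace ℝ (Fin p))
    (i j : ℕ) : ℝ :=
  ∫ y, g (cosAngle c y) *
    (cosAngle c y ^ i * inner ℝ w (y : EuclideanSpace ℝ (Fin p)) ^ (2 * j)) ∂surf p

lemma continuous_cosAngle_right (c : Sph p) : Continuous fun y : Sph p => cosAngle c y :=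
  continuous_inner_sph _

/-- Rotational symmetry in the plane of two directions `w`, `w'` orthogonal to the axis fixes the
ratio of `∫ v^{2j} v'^2` and `∫ v^{2j+2}`: the integral of `(v + β v')^{2j+2}` is
`(1 + β²)^{j+1} ∫ v^{2j+2}`, and the coefficients of `β²` are compared. -/
lemma integral_zonal_mul_inner_sq {g : ℝ → ℝ} {c : Sph p}
    (hg : Integrable (fun y => g (cosAngle c y)) (surf p))
    {w w' : EuclideanSpace ℝ (Fin p)} (hw : ‖w‖ = 1) (hw' : ‖w'‖ = 1)
    (hww' : inner ℝ w w' = 0)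
    (hwc : inner ℝ w (c : EuclideanSpace ℝ (Fin p)) = 0)
    (hwc' : inner ℝ w' (c : EuclideanSpace ℝ (Fin p)) = 0) (i j : ℕ) :
    (2 * (j : ℝ) + 1) * ∫ y, g (cosAngle c y) *
        (cosAngle c y ^ i * inner ℝ w (y : EuclideanSpace ℝ (Fin p)) ^ (2 * j) *
          inner ℝ w' (y : EuclideanSpace ℝ (Fin p)) ^ 2) ∂surf p =
      zonalMoment g c w i (j + 1) := by
  set M : ℕ → ℝ := fun k => ∫ y, g (cosAngle c y) *
        (cosAngle c y ^ i * inner ℝ w (y : EuclideanSpace ℝ (Fin p)) ^ (2 * j + 2 - k) *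
          inner ℝ w' (y : EuclideanSpace ℝ (Fin p)) ^ k) ∂surf p with hM
  have hM2 : M 2 = ∫ y, g (cosAngle c y) *
        (cosAngle c y ^ i * inner ℝ w (y : EuclideanSpace ℝ (Fin p)) ^ (2 * j) *
          inner ℝ w' (y : EuclideanSpace ℝ (Fin p)) ^ 2) ∂surf p := rfl
  have hpoly : ∑ k ∈ Finset.range (2 * j + 2 + 1), C ((2 * j + 2).choose k * M k) * X ^ k =
      C (zonalMoment g c w i (j + 1)) * (1 + X ^ 2) ^ (j + 1) := by
    refine Polynomial.funext fun β => ?_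
    have hn : ‖w + β • w'‖ = ‖Real.sqrt (1 + β ^ 2) • w‖ := by
      have h1 : ‖w + β • w'‖ ^ 2 = 1 + β ^ 2 := by
        rw [norm_add_sq_real, inner_smul_right, hww', norm_smul, hw, hw', mul_one, mul_zero,
          Real.norm_eq_abs, sq_abs]
        ring
      rw [norm_smul, hw, mul_one, Real.norm_eq_abs, abs_of_nonneg (Real.sqrt_nonneg _), ← h1,
        Real.sqrt_sq (norm_nonneg _)]
    have h := integral_zonal_mul_inner_pow g c hn
      (by rw [inner_add_left, inner_smul_left, hwc, hwc']; simp)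
      (by rw [inner_smul_left, hwc]; simp) i (2 * j + 2)
    have hr : ∀ y : Sph p, g (cosAngle c y) * (cosAngle c y ^ i *
        inner ℝ (Real.sqrt (1 + β ^ 2) • w) (y : EuclideanSpace ℝ (Fin p)) ^ (2 * j + 2)) =
        g (cosAngle c y) * (cosAngle c y ^ i *
        inner ℝ w (y : EuclideanSpace ℝ (Fin p)) ^ (2 * (j + 1))) * (1 + β ^ 2) ^ (j + 1) := by
      intro y
      have hs : Real.sqrt (1 + β ^ 2) ^ (2 * (j + 1)) = (1 + β ^ 2) ^ (j + 1) := by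
        rw [pow_mul, Real.sq_sqrt (by positivity)]
      rw [real_inner_smul_left, show 2 * j + 2 = 2 * (j + 1) by ring, mul_pow, hs]
      ring
    have hl : ∀ y : Sph p, g (cosAngle c y) * (cosAngle c y ^ i *
        inner ℝ (w + β • w') (y : EuclideanSpace ℝ (Fin p)) ^ (2 * j + 2)) =
        ∑ k ∈ Finset.range (2 * j + 2 + 1), (2 * j + 2).choose k * β ^ k * (g (cosAngle c y) *
        (cosAngle c y ^ i * inner ℝ w (y : EuclideanSpace ℝ (Fin p)) ^ (2 * j + 2 - k) *
          inner ℝ w' (y : EuclideanSpace ℝ (Fin p)) ^ k)) := by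
      intro y
      rw [inner_add_left, real_inner_smul_left, add_comm, add_pow, Finset.mul_sum, Finset.mul_sum]
      refine Finset.sum_congr rfl fun k _ => ?_
      rw [mul_pow]
      ring
    simp only [hr, hl] at h
    have hint : ∀ k, Integrable (fun y => g (cosAngle c y) * (cosAngle c y ^ i *
        inner ℝ w (y : EuclideanSpace ℝ (Fin p)) ^ (2 * j + 2 - k) *
        inner ℝ w' (y : EuclideanSpace ℝ (Fin p)) ^ k)) (surf p) := fun k =>
      integrable_zonal_mul hg ((((continuous_cosAngle_right c).pow i).mul
        ((continuous_inner_sph w).pow _)).mul ((continuous_inner_sph w').pow _))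
    rw [integral_mul_const, integral_finsetSum _ fun k _ => (hint k).const_mul _] at h
    simp only [integral_const_mul] at h
    simp only [eval_finsetSum, eval_mul, eval_pow, eval_add, eval_one, eval_C, eval_X]
    refine Eq.trans (Finset.sum_congr rfl fun k _ => ?_) h
    ring
  have hc := congrArg (fun Q : ℝ[X] => Q.coeff 2) hpoly
  have h1 : ((1 + X ^ 2 : ℝ[X]) ^ (j + 1)).coeff 2 = j + 1 := by
    have e : (1 + X ^ 2 : ℝ[X]) ^ (j + 1) = expand ℝ 2 ((1 + X) ^ (j + 1)) := by simp
    have h := coeff_expand_mul (two_pos) ((1 + X : ℝ[X]) ^ (j + 1)) 1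
    rw [one_mul] at h
    rw [e, h, coeff_one_add_X_pow]
    simp
  simp only [finsetSum_coeff, coeff_C_mul, coeff_X_pow, h1] at hc
  simp only [mul_ite, mul_one, mul_zero, Finset.sum_ite_eq, Finset.mem_range] at hc
  rw [if_pos (by omega)] at hc
  have h2 : ((2 * j + 2).choose 2 : ℝ) = (j + 1) * (2 * j + 1) := by
    rw [Nat.cast_choose_two]
    push_cast
    ring
  rw [h2] at hc
  rw [← hM2]
  have hj : (j : ℝ) + 1 ≠ 0 := by positivity
  apply mul_left_cancel₀ hj
  linarith

lemma exists_orthonormalBasis_apply_zero_one {q : ℕ} {c w : EuclideanSpace ℝ (Fin (q + 2))}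
    (hc : ‖c‖ = 1) (hw : ‖w‖ = 1) (hwc : inner ℝ w c = 0) :
    ∃ b : OrthonormalBasis (Fin (q + 2)) ℝ (EuclideanSpace ℝ (Fin (q + 2))),
      b 0 = c ∧ b 1 = w := by
  have hcw : inner ℝ c w = 0 := by rw [real_inner_comm]; exact hwc
  let v : Fin (q + 2) → EuclideanSpace ℝ (Fin (q + 2)) := fun k => if k = 0 then c else w
  have hv : Orthonormal ℝ (({0, 1} : Set (Fin (q + 2))).domRestrict v) := by
    constructor
    · rintro ⟨k, hk⟩
      by_cases h : k = 0 <;> simp [v, Set.domRestrict, h, hc, hw]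
    · rintro ⟨k, hk⟩ ⟨l, hl⟩ hkl
      rcases hk with rfl | rfl <;> rcases hl with rfl | rfl <;> simp_all [v, Set.domRestrict]
  obtain ⟨b, hb⟩ := hv.exists_orthonormalBasis_extension_of_card_eq (by simp)
  exact ⟨b, by simpa [v] using hb 0 (by simp), by simpa [v] using hb 1 (by simp)⟩

lemma exists_unit_orthogonal (hp : 2 ≤ p) {c : EuclideanSpace ℝ (Fin p)} (hc : ‖c‖ = 1) :
    ∃ w : EuclideanSpace ℝ (Fin p), ‖w‖ = 1 ∧ inner ℝ w c = 0 := by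
  obtain ⟨q, rfl⟩ := Nat.exists_eq_add_of_le' hp
  have hv : Orthonormal ℝ (({0} : Set (Fin (q + 2))).domRestrict fun _ => c) :=
    ⟨fun _ => hc, fun k l hkl => (hkl (Subsingleton.elim k l)).elim⟩
  obtain ⟨b, hb⟩ := hv.exists_orthonormalBasis_extension_of_card_eq (by simp)
  refine ⟨b 1, b.orthonormal.1 1, ?_⟩
  rw [← hb 0 rfl]
  exact b.orthonormal.2 (by simp)

/-- A unit vector in polar coordinates with respect to the axis `c`. -/
lemma exists_polar_decomposition (hp : 2 ≤ p) {c u : EuclideanSpace ℝ (Fin p)} (hc : ‖c‖ = 1)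
    (hu : ‖u‖ = 1) : ∃ (w : EuclideanSpace ℝ (Fin p)) (r : ℝ), ‖w‖ = 1 ∧ inner ℝ w c = 0 ∧
      u = (inner ℝ c u : ℝ) • c + r • w ∧ r ^ 2 = 1 - (inner ℝ c u : ℝ) ^ 2 := by
  have hcc : inner ℝ c c = (1 : ℝ) := by rw [real_inner_self_eq_norm_sq, hc, one_pow]
  have hn : ‖u - (inner ℝ c u : ℝ) • c‖ ^ 2 = 1 - (inner ℝ c u : ℝ) ^ 2 := by
    rw [norm_sub_sq_real, real_inner_smul_right, norm_smul, hu, hc, real_inner_comm,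
      Real.norm_eq_abs, mul_one, sq_abs]
    ring
  -- if `u = ± c`, any unit vector orthogonal to the axis will do
  by_cases h : u - (inner ℝ c u : ℝ) • c = 0
  · obtain ⟨w, hw, hwc⟩ := exists_unit_orthogonal hp hc
    refine ⟨w, 0, hw, hwc, ?_, ?_⟩
    · rw [zero_smul, add_zero]
      exact sub_eq_zero.1 h
    · rw [← hn, h, norm_zero]
  · have hne : ‖u - (inner ℝ c u : ℝ) • c‖ ≠ 0 := norm_ne_zero_iff.2 h
    refine ⟨(‖u - (inner ℝ c u : ℝ) • c‖)⁻¹ • (u - (inner ℝ c u : ℝ) • c),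
      ‖u - (inner ℝ c u : ℝ) • c‖, ?_, ?_, ?_, hn⟩
    · rw [norm_smul, norm_inv, norm_norm, inv_mul_cancel₀ hne]
    · rw [real_inner_smul_left, inner_sub_left, real_inner_smul_left, hcc, real_inner_comm]
      ring
    · rw [smul_smul, mul_inv_cancel₀ hne, one_smul, add_sub_cancel]

/-- The moment recurrence: in an orthonormal basis containing the axis and `w`, the squared
coordinates add up to `1`, and the `p - 2` directions orthogonal to both contribute equally. -/
lemma zonalMoment_recurrence (hp : 2 ≤ p) {g : ℝ → ℝ} {c : Sph p}
    (hg : Integrable (fun y => g (cosAngle c y)) (surf p)) {w : EuclideanSpace ℝ (Fin p)}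
    (hw : ‖w‖ = 1) (hwc : inner ℝ w (c : EuclideanSpace ℝ (Fin p)) = 0) (i j : ℕ) :
    (2 * (j : ℝ) + 1) * (zonalMoment g c w i j - zonalMoment g c w (i + 2) j) =
      (2 * j + 1 + (p - 2)) * zonalMoment g c w i (j + 1) := by
  obtain ⟨q, rfl⟩ := Nat.exists_eq_add_of_le' hp
  obtain ⟨b, hb0, hb1⟩ := exists_orthonormalBasis_apply_zero_one (c := c) (by simp) hw hwc
  set N : Fin (q + 2) → ℝ := fun k => ∫ y, g (cosAngle c y) *
        (cosAngle c y ^ i * inner ℝ w (y : EuclideanSpace ℝ (Fin (q + 2))) ^ (2 * j) *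
          inner ℝ (b k) (y : EuclideanSpace ℝ (Fin (q + 2))) ^ 2) ∂surf (q + 2) with hN
  have hint : ∀ k, Integrable (fun y => g (cosAngle c y) *
        (cosAngle c y ^ i * inner ℝ w (y : EuclideanSpace ℝ (Fin (q + 2))) ^ (2 * j) *
          inner ℝ (b k) (y : EuclideanSpace ℝ (Fin (q + 2))) ^ 2)) (surf (q + 2)) := fun k =>
    integrable_zonal_mul hg ((((continuous_cosAngle_right c).pow i).mul
      ((continuous_inner_sph w).pow _)).mul ((continuous_inner_sph (b k)).pow _))
  have hsum : ∑ k, N k = zonalMoment g c w i j := by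
    rw [hN, ← integral_finsetSum _ fun k _ => hint k, zonalMoment]
    refine integral_congr_ae (ae_of_all _ fun y => ?_)
    have h1 : ∑ k, inner ℝ (b k) (y : EuclideanSpace ℝ (Fin (q + 2))) ^ 2 = (1 : ℝ) := by
      rw [b.sum_sq_inner_right]
      simp
    simp only [← Finset.mul_sum, h1, mul_one]
  -- the axis, `w` itself, and the directions orthogonal to both
  have h0 : N 0 = zonalMoment g c w (i + 2) j := by
    rw [hN, zonalMoment]
    refine integral_congr_ae (ae_of_all _ fun y => ?_)
    simp only [hb0, cosAngle]
    ring
  have h1 : N 1 = zonalMoment g c w i (j + 1) := by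
    rw [hN, zonalMoment]
    refine integral_congr_ae (ae_of_all _ fun y => ?_)
    simp only [hb1]
    ring
  have h2 : ∀ k : Fin q, (2 * (j : ℝ) + 1) * N k.succ.succ = zonalMoment g c w i (j + 1) :=
    fun k => integral_zonal_mul_inner_sq hg hw (b.orthonormal.1 _)
      (by rw [← hb1]; exact b.orthonormal.2 (by simp [Fin.ext_iff])) hwc
      (by rw [← hb0]; exact b.orthonormal.2 (by simp [Fin.ext_iff])) i j
  rw [Fin.sum_univ_succ, Fin.sum_univ_succ, Fin.succ_zero_eq_one, h0, h1] at hsum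
  rw [← hsum, add_sub_cancel_left, mul_add, Finset.mul_sum, Finset.sum_congr rfl fun k _ => h2 k]
  simp
  ring

/-! ### The Funk–Hecke formula -/

/-- The integral of a polynomial in one coordinate against a zonal density is a polynomial in the
cosine `t` of the angle between that coordinate direction and the axis. -/
lemma integral_zonal_mul_eval {g : ℝ → ℝ} {c : Sph p}
    (hg : Integrable (fun y => g (cosAngle c y)) (surf p)) {w : EuclideanSpace ℝ (Fin p)}
    (hwc : inner ℝ w (c : EuclideanSpace ℝ (Fin p)) = 0) {t r : ℝ} (hr : r ^ 2 = 1 - t ^ 2)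
    (Q : ℝ[X]) :
    ∫ y, g (cosAngle c y) * Q.eval (t * cosAngle c y
        + r * inner ℝ w (y : EuclideanSpace ℝ (Fin p))) ∂surf p =
      (avg (zonalMoment g c w) Q).eval t := by
  have hcont : Continuous fun y : Sph p => t * cosAngle c y
        + r * inner ℝ w (y : EuclideanSpace ℝ (Fin p)) :=
    ((continuous_cosAngle_right c).const_mul t).add ((continuous_inner_sph w).const_mul r)
  induction Q using Polynomial.induction_on' with
  | add P Q hP hQ =>
    simp only [eval_add, mul_add, map_add]
    have hint : ∀ R : ℝ[X], Integrable (fun y => g (cosAngle c y) * R.eval (t * cosAngle c y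
        + r * inner ℝ w (y : EuclideanSpace ℝ (Fin p)))) (surf p) := fun R =>
      integrable_zonal_mul hg (R.continuous.comp hcont)
    rw [integral_add (hint P) (hint Q), hP, hQ]
  | monomial m a =>
    rw [← C_mul_X_pow_eq_monomial, ← smul_eq_C_mul, map_smul, avg_X_pow]
    simp only [eval_smul, eval_pow, eval_X, smul_eq_mul, mul_left_comm _ a, integral_const_mul]
    congr 1
    have hint : ∀ k, Integrable (fun y => g (cosAngle c y) * (cosAngle c y ^ (m - k) *
        inner ℝ w (y : EuclideanSpace ℝ (Fin p)) ^ k)) (surf p) := fun k =>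
      integrable_zonal_mul hg (((continuous_cosAngle_right c).pow _).mul
        ((continuous_inner_sph w).pow _))
    have hexp : ∀ y : Sph p, g (cosAngle c y) * (t * cosAngle c y
        + r * inner ℝ w (y : EuclideanSpace ℝ (Fin p))) ^ m =
        ∑ k ∈ Finset.range (m + 1), (m.choose k * t ^ (m - k) * r ^ k) *
          (g (cosAngle c y) * (cosAngle c y ^ (m - k) *
            inner ℝ w (y : EuclideanSpace ℝ (Fin p)) ^ k)) := by
      intro y
      rw [add_comm, add_pow, Finset.mul_sum]
      refine Finset.sum_congr rfl fun k _ => ?_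
      rw [mul_pow, mul_pow]
      ring
    simp only [hexp]
    rw [integral_finsetSum _ fun k _ => (hint k).const_mul _]
    simp only [integral_const_mul]
    -- odd powers of the transversal coordinate integrate to zero
    rw [← Finset.sum_filter_add_sum_filter_not _ (fun k => Even k), add_eq_left.2
      (Finset.sum_eq_zero fun k hk => by
        rw [integral_zonal_mul_inner_pow_odd g c hwc _
          (Nat.not_even_iff_odd.1 (Finset.mem_filter.1 hk).2), mul_zero])]
    rw [avgPow, eval_finsetSum]
    symm
    have hsub : (Finset.range (m + 1)).filter (fun k => Even k) ⊆
        (Finset.range (m + 1)).image (fun j => 2 * j) := by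
      intro k hk
      obtain ⟨h1, j, rfl⟩ := Finset.mem_filter.1 hk
      have := Finset.mem_range.1 h1
      exact Finset.mem_image.2 ⟨j, Finset.mem_range.2 (by omega), by ring⟩
    rw [Finset.sum_subset hsub (fun k hk hk' => ?_), Finset.sum_image (by simp)]
    · refine Finset.sum_congr rfl fun j _ => ?_
      simp only [eval_mul, eval_C, eval_pow, eval_X, eval_sub, eval_one, ← hr, zonalMoment]
      ring
    · obtain ⟨j, -, rfl⟩ := Finset.mem_image.1 hk
      have : m < 2 * j := by
        by_contra hlt
        exact hk' (Finset.mem_filter.2 ⟨Finset.mem_range.2 (by omega), even_two_mul j⟩)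
      rw [Nat.choose_eq_zero_of_lt this]
      simp

/-- The **Funk–Hecke formula**: integration against a zonal density multiplies Legendre
polynomials, as functions of the pole `u`, by the Fourier coefficients of the density. -/
theorem funk_hecke (hp : 2 ≤ p) {g : ℝ → ℝ} {c : Sph p}
    (hg : Integrable (fun y => g (cosAngle c y)) (surf p)) (u : Sph p) (ℓ : ℕ) :
    ∫ y, g (cosAngle c y) * (legendre p ℓ).eval (cosAngle u y) ∂surf p =
      fourierCoeff g c ℓ * (legendre p ℓ).eval (cosAngle u c) := by
  obtain ⟨w, r, hw, hwc, hu, hr⟩ := exists_polar_decomposition hp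
    (c := (c : EuclideanSpace ℝ (Fin p))) (u := u) (by simp) (by simp)
  change _ = cosAngle c u • _ + _ at hu
  change _ = 1 - cosAngle c u ^ 2 at hr
  set Q := avg (zonalMoment g c w) (legendre p ℓ) with hQ
  have heig : gegenbauerOp ((p : ℝ) - 2) Q = -(C ((ℓ : ℝ) * (ℓ + (p - 2))) * Q) := by
    rw [hQ, gegenbauerOp_avg _ _ (zonalMoment_recurrence hp hg hw hwc),
      gegenbauerOp_legendre p hp, map_neg, ← smul_eq_C_mul, map_smul, smul_eq_C_mul]
  have h1 : Q.eval 1 = fourierCoeff g c ℓ := by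
    rw [hQ, ← integral_zonal_mul_eval hg hwc (t := 1) (r := 0) (by norm_num), fourierCoeff]
    simp
  have h2 := integral_zonal_mul_eval hg hwc hr (legendre p ℓ)
  have h3 : ∀ y, cosAngle c u * cosAngle c y + r * inner ℝ w (y : EuclideanSpace ℝ (Fin p)) =
      cosAngle u y := by
    intro y
    rw [cosAngle.eq_def u, hu, inner_add_left, real_inner_smul_left, real_inner_smul_left]
    rfl
  simp only [h3] at h2
  rw [h2, ← hQ, eq_eval_one_mul_legendre p hp ℓ heig, eval_mul, eval_C, h1, cosAngle_comm u c]

/-! ### Transition kernels and moments of the walk -/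

lemma measurable_stepDensity {g : ℝ → ℝ} (hg : Measurable g) :
    Measurable (Function.uncurry fun c y : Sph p => ENNReal.ofReal (g (cosAngle c y))) :=
  (hg.comp continuous_cosAngle.measurable).ennreal_ofReal

/-- The transition kernel of a step of the walk: from `c`, the density is `y ↦ g (cᵀy)`. -/
noncomputable def stepKernel (p : ℕ) (g : ℝ → ℝ) : Kernel (Sph p) (Sph p) :=
  Kernel.withDensity (Kernel.const (Sph p) (surf p)) fun c y => ENNReal.ofReal (g (cosAngle c y))

lemma stepKernel_apply {g : ℝ → ℝ} (hg : Measurable g) (c : Sph p) :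
    stepKernel p g c = (surf p).withDensity fun y => ENNReal.ofReal (g (cosAngle c y)) := by
  rw [stepKernel, Kernel.withDensity_apply _ (measurable_stepDensity hg), Kernel.const_apply]

lemma stepKernel_apply_eq_ofReal {g : ℝ → ℝ} (hg : IsZonalPDF p g) (c : Sph p) {A : Set (Sph p)}
    (hA : MeasurableSet A) :
    stepKernel p g c A = ENNReal.ofReal (∫ y in A, g (cosAngle c y) ∂surf p) := by
  rw [stepKernel_apply hg.measurable, withDensity_apply _ hA,
    ofReal_integral_eq_lintegral_ofReal (hg.integrable c).integrableOn
      (ae_of_all _ fun y => hg.nonneg _ (cosAngle_mem_Icc c y))]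

lemma isMarkovKernel_stepKernel {g : ℝ → ℝ} (hg : IsZonalPDF p g) :
    IsMarkovKernel (stepKernel p g) := by
  refine ⟨fun c => ⟨?_⟩⟩
  rw [stepKernel_apply_eq_ofReal hg c .univ, setIntegral_univ, hg.integral_eq_one,
    ENNReal.ofReal_one]

lemma integral_stepKernel {g : ℝ → ℝ} (hg : IsZonalPDF p g) (c : Sph p) (f : Sph p → ℝ) :
    ∫ y, f y ∂stepKernel p g c = ∫ y, g (cosAngle c y) * f y ∂surf p := by
  have hm : Measurable fun y => g (cosAngle c y) :=
    hg.measurable.comp (continuous_cosAngle_right c).measurable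
  rw [stepKernel_apply hg.measurable, integral_withDensity_eq_integral_toReal_smul
    hm.ennreal_ofReal (ae_of_all _ fun _ => ENNReal.ofReal_lt_top)]
  refine integral_congr_ae (ae_of_all _ fun y => ?_)
  simp only [ENNReal.toReal_ofReal (hg.nonneg _ (cosAngle_mem_Icc c y)), smul_eq_mul]

section Walk

variable {Ω : Type*} [MeasurableSpace Ω] {P : Measure Ω} {n : ℕ} {μ : Sph p} {g : ℕ → ℝ → ℝ}
  {x : ℕ → Ω → Sph p}

lemma past_le (hx : IsIsotropicWalk P n μ g x) {k : ℕ} (hk : k ≤ n) :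
    past x k ≤ (inferInstance : MeasurableSpace Ω) :=
  iSup₂_le fun j hj => (hx.measurable j (hj.trans hk)).comap_le

variable [IsProbabilityMeasure P]

/-- The joint law of two consecutive positions; only the conditional law of `x (k + 1)` given the
last position enters, by testing on events of the form `x k ∈ B`. -/
lemma map_prodMk_eq_compProd (hx : IsIsotropicWalk P n μ g x) {k : ℕ} (hk : k < n) :
    P.map (fun ω => (x k ω, x (k + 1) ω)) = P.map (x k) ⊗ₘ stepKernel p (g k) := by
  have hg := hx.density k hk
  have := isMarkovKernel_stepKernel hg
  have hm := hx.measurable k hk.le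
  have hm' := hx.measurable (k + 1) hk
  have := Measure.isProbabilityMeasure_map (μ := P) hm.aemeasurable
  have := Measure.isProbabilityMeasure_map (μ := P) (hm.prodMk hm').aemeasurable
  refine Measure.ext_prod fun {B A} hB hA => ?_
  rw [Measure.map_apply (hm.prodMk hm') (hB.prod hA), Measure.compProd_apply_prod hB hA,
    setLIntegral_map hB (Kernel.measurable_coe _ hA) hm]
  have hle := past_le hx hk.le
  have hBm : MeasurableSet[past x k] (x k ⁻¹' B) :=
    le_iSup₂ (f := fun j (_ : j ≤ k) => MeasurableSpace.comap (x j) inferInstance) k le_rfl _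
      ⟨B, hB, rfl⟩
  have hAm : MeasurableSet (x (k + 1) ⁻¹' A) := hm' hA
  have hint : Integrable ((x (k + 1) ⁻¹' A).indicator fun _ => (1 : ℝ)) P :=
    (integrable_const 1).indicator hAm
  have h1 := setIntegral_condExp hle hint hBm
  rw [setIntegral_congr_ae (hle _ hBm) ((hx.step k hk A hA).mono fun ω hω _ => hω),
    setIntegral_indicator hAm, setIntegral_one_eq_measureReal] at h1
  have hset : (fun ω => (x k ω, x (k + 1) ω)) ⁻¹' B ×ˢ A = x k ⁻¹' B ∩ x (k + 1) ⁻¹' A := rfl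
  rw [hset, ← ofReal_measureReal, ← h1, ofReal_integral_eq_lintegral_ofReal]
  · exact lintegral_congr fun ω => (stepKernel_apply_eq_ofReal hg _ hA).symm
  · exact (integrable_condExp.congr (hx.step k hk A hA)).integrableOn
  · exact ae_of_all _ fun ω => setIntegral_nonneg hA fun y _ =>
      hg.nonneg _ (cosAngle_mem_Icc _ y)

lemma condExp_comp_consecutive (hx : IsIsotropicWalk P n μ g x) {k : ℕ} (hk : k < n)
    {f : Sph p × Sph p → ℝ} (hf : Continuous f) :
    P[fun ω => f (x k ω, x (k + 1) ω) | MeasurableSpace.comap (x k) inferInstance] =ᵐ[P]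
      fun ω => ∫ y, g k (cosAngle (x k ω) y) * f (x k ω, y) ∂surf p := by
  have hg := hx.density k hk
  have := isMarkovKernel_stepKernel hg
  have hm := hx.measurable k hk.le
  have hm' := hx.measurable (k + 1) hk
  have : Nonempty (Sph p) := ⟨μ⟩
  obtain ⟨C, hC⟩ := isCompact_univ.exists_bound_of_continuousOn hf.continuousOn
  have hint : Integrable (fun ω => f (x k ω, x (k + 1) ω)) P :=
    Integrable.of_bound (hf.measurable.comp (hm.prodMk hm')).aestronglyMeasurable C
      (ae_of_all _ fun ω => hC _ trivial)
  have h1 := condExp_prod_ae_eq_integral_condDistrib hm hm'.aemeasurable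
    hf.stronglyMeasurable hint
  have h2 := ae_of_ae_map hm.aemeasurable (condDistrib_ae_eq_of_measure_eq_compProd_of_measurable
    hm hm' (map_prodMk_eq_compProd hx hk))
  filter_upwards [h1, h2] with ω hω1 hω2
  rw [hω1, hω2, integral_stepKernel hg]

/-- The martingale-type property behind the product formula: one step of the walk multiplies the
mean of the `ℓ`-th Legendre polynomial with pole `u` by the `ℓ`-th Fourier coefficient. -/
lemma integral_legendre_succ (hp : 2 ≤ p) (hx : IsIsotropicWalk P n μ g x) {k : ℕ} (hk : k < n)
    (u : Sph p) (ℓ : ℕ) :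
    ∫ ω, (legendre p ℓ).eval (cosAngle u (x (k + 1) ω)) ∂P =
      fourierCoeff (g k) μ ℓ * ∫ ω, (legendre p ℓ).eval (cosAngle u (x k ω)) ∂P := by
  have h := condExp_comp_consecutive hx hk (f := fun q => (legendre p ℓ).eval (cosAngle u q.2))
    ((legendre p ℓ).continuous.comp ((continuous_cosAngle_right u).comp continuous_snd))
  rw [← integral_condExp (hx.measurable k hk.le).comap_le, integral_congr_ae h,
    ← integral_const_mul]
  refine integral_congr_ae (ae_of_all _ fun ω => ?_)
  simp only [funk_hecke hp ((hx.density k hk).integrable (x k ω)) u ℓ,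
    fourierCoeff_eq (g k) (x k ω) μ]

/-- The Legendre moments of the `n`-step distribution about an arbitrary pole `u`. -/
lemma integral_legendre (hp : 2 ≤ p) (hx : IsIsotropicWalk P n μ g x) (u : Sph p) (ℓ : ℕ)
    {k : ℕ} (hk : k ≤ n) :
    ∫ ω, (legendre p ℓ).eval (cosAngle u (x k ω)) ∂P =
      (∏ j ∈ Finset.range k, fourierCoeff (g j) μ ℓ) * (legendre p ℓ).eval (cosAngle u μ) := by
  induction k with
  | zero =>
    rw [integral_congr_ae (hx.init.mono fun ω hω =>
      show _ = (legendre p ℓ).eval (cosAngle u μ) by simp only [hω])]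
    simp
  | succ k ih =>
    rw [integral_legendre_succ hp hx hk, ih (by omega), Finset.prod_range_succ]
    ring

end Walk

end SphereWalk

theorem mainTheorem3 {p : ℕ} (hp : 2 ≤ p) {Ω : Type*} [MeasurableSpace Ω]
    (P : MeasureTheory.Measure Ω) [MeasureTheory.IsProbabilityMeasure P]
    (n : ℕ) (hn : 1 ≤ n) (μ : SphereWalk.Sph p) (g : ℕ → ℝ → ℝ)
    (x : ℕ → Ω → SphereWalk.Sph p) (hx : SphereWalk.IsIsotropicWalk P n μ g x) :
    (∀ k < n,
      P[fun ω => SphereWalk.cosAngle (x k ω) (x (k + 1) ω) |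
          MeasurableSpace.comap (x k) inferInstance]
        =ᵐ[P] fun _ => SphereWalk.meanResultant (g k) μ) ∧
    (∫ ω, (x n ω : EuclideanSpace ℝ (Fin p)) ∂P
      = (∏ k ∈ Finset.range n, SphereWalk.meanResultant (g k) μ) •
          (μ : EuclideanSpace ℝ (Fin p))) ∧
    (∀ ℓ : ℕ, ∀ k < n,
      P[fun ω => (SphereWalk.legendre p ℓ).eval
            (SphereWalk.cosAngle (x k ω) (x (k + 1) ω)) |
          MeasurableSpace.comap (x k) inferInstance]
        =ᵐ[P] fun _ => SphereWalk.fourierCoeff (g k) μ ℓ) ∧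
    (∀ ℓ : ℕ,
      ∫ ω, (SphereWalk.legendre p ℓ).eval (SphereWalk.cosAngle μ (x n ω)) ∂P
        = ∏ k ∈ Finset.range n, SphereWalk.fourierCoeff (g k) μ ℓ) := by
  have hleg : ∀ ℓ : ℕ, ∀ k < n,
      P[fun ω => (SphereWalk.legendre p ℓ).eval
            (SphereWalk.cosAngle (x k ω) (x (k + 1) ω)) |
          MeasurableSpace.comap (x k) inferInstance]
        =ᵐ[P] fun _ => SphereWalk.fourierCoeff (g k) μ ℓ := by
    intro ℓ k hk
    refine (SphereWalk.condExp_comp_consecutive hx hk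
      (f := fun q => (SphereWalk.legendre p ℓ).eval (SphereWalk.cosAngle q.1 q.2))
      ((SphereWalk.legendre p ℓ).continuous.comp SphereWalk.continuous_cosAngle)).trans
      (ae_of_all _ fun ω => ?_)
    exact SphereWalk.fourierCoeff_eq (g k) (x k ω) μ ℓ
  refine ⟨fun k hk => ?_, ?_, hleg, fun ℓ => ?_⟩
  · have h := hleg 1 k hk
    simpa only [SphereWalk.legendre_one p hp, eval_X,
      ← SphereWalk.meanResultant_eq_fourierCoeff_one hp] using h
  · have hm := hx.measurable n le_rfl
    have hint : Integrable (fun ω => (x n ω : EuclideanSpace ℝ (Fin p))) P :=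
      Integrable.of_bound (measurable_subtype_coe.comp hm).aestronglyMeasurable 1
        (ae_of_all _ fun ω => by simp)
    -- the coordinates of the mean are first Legendre moments about the coordinate axes
    refine (EuclideanSpace.basisFun (Fin p) ℝ).repr.injective (PiLp.ext fun i => ?_)
    have h := SphereWalk.integral_legendre hp hx
      (⟨EuclideanSpace.basisFun (Fin p) ℝ i, by simp⟩ : SphereWalk.Sph p) 1 le_rfl
    simp only [SphereWalk.legendre_one p hp, eval_X, SphereWalk.cosAngle,
      ← SphereWalk.meanResultant_eq_fourierCoeff_one hp] at h
    rw [OrthonormalBasis.repr_apply_apply, OrthonormalBasis.repr_apply_apply,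
      ← integral_inner hint, real_inner_smul_right]
    exact h
  · rw [SphereWalk.integral_legendre hp hx μ ℓ le_rfl, SphereWalk.cosAngle_self,
      SphereWalk.legendre_eval_one p hp, mul_one]
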